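/- **Conventions.** Let $\mathcal C$ be a category. A class $\mathcal P$ of morphisms in $\mathcal C$ is called a *QE-epi class* if * (i\*) for any morphisms $p\colon D\to E$ and $f\colon E'\to E$ in $\mathcal C$ with $p\in\mathcal P$, the pullback of $p$ along $f$ exists in $\mathcal C$, and for every pullback square $D'=D\times_E E'$ the morphism $p'\colon D'\to E'$ belongs to $\mathcal P$; * (ii\*) every morphism $p\in\mathcal P$ is the coequalizer of its kernel pair (the pullback of the cospan $(p,p)$); * (iii\*) all identity morphisms belong to $\mathcal P$, and $\mathcal P$ is closed under compositions. A QE-epi class $\mathcal P$ is called *strong* if, moreover, * (iv\*) for any composable pair of morphisms $p$, $q$ in $\mathcal C$, if $p\circ q\in\mathcal P$ then $p\in\mathcal P$. A *$\mathcal P$-sequence* is a diagram $K\rightrightarrows D\xrightarrow{p}E$ with $p\in\mathcal P$ and with $K\rightrightarrows D$ the kernel pair of $p$. Let $\kappa$ be a regular cardinal, let $\mathcal A$ be a $\kappa$-accessible category, and let $\mathcal A_{<\kappa}\subset\mathcal A$ be the full subcategory of $\kappa$-presentable objects. Denote by $\mathcal A^\to$ the category of morphisms of $\mathcal A$, by $\mathcal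 A_{<\kappa}^\to\subset\mathcal A^\to$ the full subcategory of all morphisms with $\kappa$-presentable domain and codomain, and by $\varinjlim_{(\kappa)}\mathcal Q\subset\mathcal A^\to$ the class of all $\kappa$-directed colimits in $\mathcal A^\to$ of morphisms from $\mathcal Q$, for a class $\mathcal Q$ of morphisms in $\mathcal A_{<\kappa}$. A QE-epi class $\mathcal P$ in $\mathcal A$ is called *strongly locally $\kappa$-coherent* if * the $\mathcal P$-sequences are precisely all the $\kappa$-directed colimits of $\mathcal P$-sequences $K\rightrightarrows D\to E$ with $K$, $D$, $E\in\mathcal A_{<\kappa}$, where the colimits are taken in the category of commutative diagrams $K\rightrightarrows D\to E$ in $\mathcal A$ (that is, with both compositions $K\to E$ equal); and * for any pullback square of a morphism $p\colon D\to E$, $p\in\mathcal P$, along a morphism $f\colon E'\to E$ in $\mathcal A$ with $D$, $E$, $E'\in\mathcal A_{<\kappa}$, the pullback $D'=D\times_E E'$ also belongs to $\mathcal A_{<\kappa}$. **Theorem.** Let $\kappa$ be a regular cardinal and $\mathcal A$ a $\kappa$-accessible category with finite coproducts. 1. For any strong QE-epi class $\mathcal Q$ in the category $\mathcal A_{<\kappa}$,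 the class $\varinjlim_{(\kappa)}\mathcal Q$ is a strongly locally $\kappa$-coherent strong QE-epi class in the category $\mathcal A$. 2. Conversely, for any strongly locally $\kappa$-coherent strong QE-epi class $\mathcal P$ in $\mathcal A$, the class $\mathcal P\cap\mathcal A_{<\kappa}^\to$ is a strong QE-epi class in the category $\mathcal A_{<\kappa}$. -/

import Mathlib

open CategoryTheory Limits

universe w v u

namespace QE

section Classes

variable {C : Type u} [Category.{v} C]

/-- A QE-epi class `P` of morphisms in a category `C`:
* every cospan `p : D ⟶ E`, `f : E' ⟶ E` with `p` in `P` has a pullback, and `P` is stable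
  under pullbacks;
* every morphism in `P` is the coequalizer of its kernel pair (the choice of the kernel pair
  does not matter, so this is required for all of them);
* `P` contains all identity morphisms and is closed under composition. -/
structure IsQEEpiClass (P : MorphismProperty C) : Prop where
  hasPullback : ∀ {D E E' : C} (p : D ⟶ E) (f : E' ⟶ E), P p → HasPullback p f
  stable : ∀ {D E D' E' : C} {p : D ⟶ E} {f : E' ⟶ E} {f' : D' ⟶ D} {p' : D' ⟶ E'},
    IsPullback f' p' p f → P p → P p'
  coequalizer : ∀ {K D E : C} {p : D ⟶ E} {k₁ k₂ : K ⟶ D} (h : IsKernelPair p k₁ k₂), P p →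
    Nonempty (IsColimit (Cofork.ofπ p h.w))
  id_mem : ∀ X : C, P (𝟙 X)
  comp_mem : ∀ {X Y Z : C} (f : X ⟶ Y) (g : Y ⟶ Z), P f → P g → P (f ≫ g)

/-- A strong QE-epi class: a QE-epi class `P` such that `p` belongs to `P` whenever
the composition `p ∘ q` does. -/
structure IsStrongQEEpiClass (P : MorphismProperty C) : Prop extends IsQEEpiClass P where
  of_comp : ∀ {X Y Z : C} (q : X ⟶ Y) (p : Y ⟶ Z), P (q ≫ p) → P p

/-- The finite category with three objects and four nonidentity morphisms which is the shape of
commutative diagrams `K ⇉ D ⟶ E` (both compositions `K ⟶ E` being equal): the parallel pair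
`zero ⇉ one` with a terminal object adjoined. -/
abbrev ForkShape : Type := WithTerminal WalkingParallelPair

/-- The `P`-sequences: diagrams `K ⇉ D ⟶ E` consisting of a morphism `D ⟶ E` from `P`
and of its kernel pair `K ⇉ D`. -/
def sequences (P : MorphismProperty C) : ObjectProperty (ForkShape ⥤ C) := fun F =>
  P (F.map (WithTerminal.homFrom WalkingParallelPair.one)) ∧
    IsKernelPair (F.map (WithTerminal.homFrom WalkingParallelPair.one))
      (F.map (WithTerminal.incl.map WalkingParallelPairHom.left))
      (F.map (WithTerminal.incl.map WalkingParallelPairHom.right))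

variable (κ : Cardinal.{w}) [Fact κ.IsRegular]

/-- The objects that are colimits of diagrams of objects satisfying `T`, indexed by (small)
`κ`-directed posets. For a poset, `IsCardinalFiltered` says that every subset of cardinality
smaller than `κ` has an upper bound. -/
def directedColimits (T : ObjectProperty C) : ObjectProperty C := fun X =>
  ∃ (J : Type w) (_ : PartialOrder J) (_ : IsCardinalFiltered J κ), T.colimitsOfShape J X

/-- The morphisms that are colimits of diagrams of morphisms from `W`, indexed by (small)
`κ`-directed posets. As usual, a diagram of morphisms is a natural transformation, and its
colimit is the morphism induced on the colimits of the domains and of the codomains; this is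
the colimit in the category of morphisms. -/
def directedColimitsHom (W : MorphismProperty C) : MorphismProperty C := fun _ _ f =>
  ∃ (J : Type w) (_ : PartialOrder J) (_ : IsCardinalFiltered J κ), W.colimitsOfShape J f

variable (C) in
/-- The full subcategory of `κ`-presentable objects. -/
abbrev Presentables := (isCardinalPresentable C κ).FullSubcategory

/-- A class of morphisms in the full subcategory of `κ`-presentable objects, regarded as
a class of morphisms in the ambient category. -/
def extend (Q : MorphismProperty (Presentables C κ)) : MorphismProperty C := fun X Y f =>
  ∃ (hX : isCardinalPresentable C κ X) (hY : isCardinalPresentable C κ Y),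
    Q (ObjectProperty.homMk f : (⟨X, hX⟩ : Presentables C κ) ⟶ ⟨Y, hY⟩)

/-- The class of all `κ`-directed colimits in the category of morphisms of `C` of the morphisms
belonging to a class `Q` of morphisms between `κ`-presentable objects. -/
def lim (Q : MorphismProperty (Presentables C κ)) : MorphismProperty C :=
  directedColimitsHom κ (extend κ Q)

/-- The class of all morphisms from `P` with `κ`-presentable domains and codomains, regarded as
a class of morphisms in the full subcategory of `κ`-presentable objects. -/
def restrict (P : MorphismProperty C) : MorphismProperty (Presentables C κ) := fun _ _ f =>
  P f.hom

/-- A QE-epi class `P` is locally `κ`-coherent if the `P`-sequences are precisely the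
`κ`-directed colimits (in the diagram category) of `P`-sequences whose three terms are
`κ`-presentable. -/
structure IsLocallyCoherent (P : MorphismProperty C) : Prop extends IsQEEpiClass P where
  sequences_iff : ∀ F : ForkShape ⥤ C, sequences P F ↔
    directedColimits κ (fun G : ForkShape ⥤ C =>
      sequences P G ∧ ∀ i, isCardinalPresentable C κ (G.obj i)) F

/-- A locally `κ`-coherent QE-epi class `P` is strongly locally `κ`-coherent if, for every
pullback square of a morphism `p : D ⟶ E` from `P` along `f : E' ⟶ E` with `D`, `E`, `E'`
`κ`-presentable, the pullback `D'` is `κ`-presentable, too. -/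
structure IsStronglyLocallyCoherent (P : MorphismProperty C) : Prop
    extends IsLocallyCoherent κ P where
  presentable_pullback : ∀ {D E D' E' : C} {p : D ⟶ E} {f : E' ⟶ E} {f' : D' ⟶ D} {p' : D' ⟶ E'},
    IsPullback f' p' p f → P p → isCardinalPresentable C κ D → isCardinalPresentable C κ E →
      isCardinalPresentable C κ E' → isCardinalPresentable C κ D'

end Classes

end QE

namespace QE

/-! ### Size and filteredness of index categories -/

section IndexCategories

universe v₁ v₂ v₃ u₁ u₂ u₃

/-! The class `lim κ Q` is handled through a factorization criterion, `HasLifts`: `p` belongs to it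
iff every morphism from an arrow `G ⟶ H` between `κ`-presentable objects to `p` factors through an
arrow of `Q` with the same codomain `H`. For a `κ`-directed colimit of arrows of `Q` this holds
because the given square factors through a stage, where one pulls back (`lim_hasLifts`). Conversely,
the criterion makes the arrows of `Q` cofinal among all `κ`-presentable arrows over `p`, so `p` is
their colimit (`lim_of_hasLifts`). Stability under pullback, closure under composition and the
strong axiom are then formal; the last uses coproducts.

The criterion also makes the `κ`-presentable objects over a cospan with leg `p` a `κ`-filtered
category, whose colimit is the pullback (`hasPullback_of_hasLifts`). The coequalizer property is
proved for arrows of `Q` against all targets in `A`, then passed to colimits (`exists_desc_lim`).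
For coherence, `κ`-directed colimits commute with pullbacks, and an arrow of `lim κ Q` between
`κ`-presentable objects is already in `Q` (`extend_of_lim`).

For the converse statement, the inclusion of the `κ`-presentable objects is dense, hence preserves
pullbacks (`isPullback_hom`), and strong coherence keeps the needed pullbacks inside the
subcategory. -/

lemma essentiallySmall_comma {X : Type u₁} [Category.{v₁} X] {Y : Type u₂} [Category.{v₂} Y]
    {T : Type u₃} [Category.{v₃} T] [EssentiallySmall.{w} X] [EssentiallySmall.{w} Y]
    [LocallySmall.{w} T] (L : X ⥤ T) (R : Y ⥤ T) : EssentiallySmall.{w} (Comma L R) := by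
  let eX := (equivSmallModel.{w} X).inverse
  let eY := (equivSmallModel.{w} Y).inverse
  let Φ : Comma (eX ⋙ L) (eY ⋙ R) ⥤ Comma L R :=
    Comma.preLeft eX L (eY ⋙ R) ⋙ Comma.preRight L eY R
  rw [← essentiallySmall_congr Φ.asEquivalence]
  have : Small.{w} (Comma (eX ⋙ L) (eY ⋙ R)) :=
    small_of_surjective (f := fun (f : Σ (x : SmallModel.{w} X) (y : SmallModel.{w} Y),
      L.obj (eX.obj x) ⟶ R.obj (eY.obj y)) ↦ (⟨f.1, f.2.1, f.2.2⟩ : Comma (eX ⋙ L) (eY ⋙ R)))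
      (fun f ↦ ⟨⟨f.left, f.right, f.hom⟩, rfl⟩)
  exact essentiallySmall_of_small_of_locallySmall _

lemma hasCardinalLT_of_arrow {κ : Cardinal.{w}} {S : Type u₁} [Category.{v₁} S]
    (hS : HasCardinalLT (Arrow S) κ) : HasCardinalLT S κ :=
  hS.of_injective (fun s ↦ Arrow.mk (𝟙 s)) (fun _ _ h ↦ congrArg Arrow.leftFunc.obj h)

variable {κ : Cardinal.{w}} [Fact κ.IsRegular]

/-- In a `κ`-filtered category, given objects `x`, `y` and fewer than `κ` objects with morphisms
to both `x` and `y`, one may complete to commutative squares. -/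
lemma exists_commSq {J : Type u₁} [Category.{v₁} J] [IsCardinalFiltered J κ] {S : Type u₂}
    (hS : HasCardinalLT S κ) {z : S → J} {x y : J} (f : ∀ s, z s ⟶ x) (g : ∀ s, z s ⟶ y) :
    ∃ (t : J) (a : x ⟶ t) (b : y ⟶ t), ∀ s, f s ≫ a = g s ≫ b := by
  have := isFiltered_of_isCardinalFiltered J κ
  obtain ⟨t, c, hc⟩ := IsCardinalFiltered.multicoequalizer
    (fun s ↦ f s ≫ IsFiltered.leftToMax x y) (fun s ↦ g s ≫ IsFiltered.rightToMax x y) hS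
  exact ⟨t, _, _, fun s ↦ by simpa using hc s⟩

/-- Nothing is asked of `L`: cocones chosen separately on the two sides become compatible after
enlarging the right-hand vertex. -/
lemma isCardinalFiltered_comma_id {X : Type u₁} [Category.{v₁} X] {Y : Type u₂} [Category.{v₂} Y]
    [IsCardinalFiltered X κ] [IsCardinalFiltered Y κ] (L : X ⥤ Y) :
    IsCardinalFiltered (Comma L (𝟭 Y)) κ where
  nonempty_cocone {S} _ F hS := by
    let c₁ := IsCardinalFiltered.cocone (F ⋙ Comma.fst _ _) hS
    let c₂ := IsCardinalFiltered.cocone (F ⋙ Comma.snd _ _) hS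
    obtain ⟨t, a, b, h⟩ := exists_commSq (hasCardinalLT_of_arrow hS)
      (fun s ↦ L.map (c₁.ι.app s)) (fun s ↦ (F.obj s).hom ≫ c₂.ι.app s)
    exact ⟨{
      pt := ⟨c₁.pt, t, a⟩
      ι.app s :=
        { left := c₁.ι.app s
          right := c₂.ι.app s ≫ b
          w := (h s).trans (Category.assoc _ _ _) }
      ι.naturality s s' f := by
        ext
        · simpa using c₁.w f
        · simpa using c₂.w_assoc f b }⟩

lemma isCardinalFiltered_of_fullyFaithful {X : Type u₁} [Category.{v₁} X] {Y : Type u₂}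
    [Category.{v₂} Y] [IsCardinalFiltered Y κ] (F : X ⥤ Y) [F.Full] [F.Faithful]
    (hF : ∀ y, ∃ x, Nonempty (y ⟶ F.obj x)) : IsCardinalFiltered X κ where
  nonempty_cocone {S} _ G hS := by
    let c := IsCardinalFiltered.cocone (G ⋙ F) hS
    obtain ⟨x, ⟨f⟩⟩ := hF c.pt
    exact ⟨{
      pt := x
      ι.app s := F.preimage (c.ι.app s ≫ f)
      ι.naturality s s' g := F.map_injective (by simpa using c.w_assoc g f) }⟩

end IndexCategories

/-! ### Testing on `κ`-presentable objects -/

section Density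

lemma isPullback_of_hom {A : Type u} [Category.{v} A] {κ : Cardinal.{w}} [Fact κ.IsRegular]
    {P X Y Z : Presentables A κ} {fst : P ⟶ X} {snd : P ⟶ Y} {f : X ⟶ Z}
    {g : Y ⟶ Z} (h : IsPullback fst.hom snd.hom f.hom g.hom) : IsPullback fst snd f g :=
  IsPullback.of_map (isCardinalPresentable A κ).ι (ObjectProperty.hom_ext _ h.w) h

variable {A : Type u} [Category.{v} A] (κ : Cardinal.{w}) [Fact κ.IsRegular]
  [IsCardinalAccessibleCategory A κ]

lemma hom_ext_of_presentable {X Y : A} {f g : X ⟶ Y}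
    (h : ∀ ⦃T : A⦄ (_ : isCardinalPresentable A κ T) (t : T ⟶ X), t ≫ f = t ≫ g) : f = g :=
  ((isCardinalPresentable A κ).ι.denseAt X).hom_ext' (fun T t ↦
    congr(𝟙 T.obj ≫ $(h T.property t)))

/-- Morphisms from an object of a `κ`-accessible category can be defined on the morphisms from
`κ`-presentable objects. -/
lemma exists_hom_of_presentable {X Y : A}
    (φ : ∀ ⦃T : A⦄ (_ : isCardinalPresentable A κ T), (T ⟶ X) → (T ⟶ Y))
    (hφ : ∀ ⦃T T' : A⦄ (hT : isCardinalPresentable A κ T) (hT' : isCardinalPresentable A κ T')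
      (f : T ⟶ T') (t : T' ⟶ X), φ hT (f ≫ t) = f ≫ φ hT' t) :
    ∃ f : X ⟶ Y, ∀ ⦃T : A⦄ (hT : isCardinalPresentable A κ T) (t : T ⟶ X), t ≫ f = φ hT t := by
  let c : Cocone (CostructuredArrow.proj (isCardinalPresentable A κ).ι X ⋙
      (isCardinalPresentable A κ).ι) :=
    { pt := Y
      ι.app g := φ g.left.property g.hom
      ι.naturality g₁ g₂ f := by
        have := hφ g₁.left.property g₂.left.property f.left.hom g₂.hom
        have h : f.left.hom ≫ g₂.hom = g₁.hom := CostructuredArrow.w f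
        rw [h] at this
        exact this.symm.trans (Category.comp_id _).symm }
  refine ⟨((isCardinalPresentable A κ).ι.denseAt X).desc c, fun T hT t ↦ ?_⟩
  have := ((isCardinalPresentable A κ).ι.denseAt X).fac c
    (CostructuredArrow.mk (S := (isCardinalPresentable A κ).ι) (Y := ⟨T, hT⟩) (by exact t))
  refine Eq.trans ?_ this
  exact congr($((Category.id_comp t).symm) ≫ _)

/-- Lifts defined on `κ`-presentable test objects are unique, hence natural in the test object, and
so glue by density. -/
lemma isPullback_of_presentable {P X Y Z : A} {fst : P ⟶ X} {snd : P ⟶ Y} {f : X ⟶ Z} {g : Y ⟶ Z}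
    (w : fst ≫ f = snd ≫ g)
    (exists_lift : ∀ ⦃T : A⦄ (_ : isCardinalPresentable A κ T) (a : T ⟶ X) (b : T ⟶ Y),
      a ≫ f = b ≫ g → ∃ l : T ⟶ P, l ≫ fst = a ∧ l ≫ snd = b)
    (hom_ext : ∀ ⦃T : A⦄ (_ : isCardinalPresentable A κ T) (l l' : T ⟶ P),
      l ≫ fst = l' ≫ fst → l ≫ snd = l' ≫ snd → l = l') :
    IsPullback fst snd f g := by
  have key (s : PullbackCone f g) : ∃ l : s.pt ⟶ P, l ≫ fst = s.fst ∧ l ≫ snd = s.snd := by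
    choose φ hφ₁ hφ₂ using fun ⦃T : A⦄ (hT : isCardinalPresentable A κ T) (t : T ⟶ s.pt) ↦
      exists_lift hT (t ≫ s.fst) (t ≫ s.snd) (by simp [s.condition])
    obtain ⟨l, hl⟩ := exists_hom_of_presentable κ φ
      (fun T T' hT hT' f t ↦ hom_ext hT _ _ (by simp [hφ₁]) (by simp [hφ₂]))
    exact ⟨l, hom_ext_of_presentable κ fun T hT t ↦ by rw [← hφ₁ hT, ← hl hT, Category.assoc],
      hom_ext_of_presentable κ fun T hT t ↦ by rw [← hφ₂ hT, ← hl hT, Category.assoc]⟩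
  choose l hl₁ hl₂ using key
  refine ⟨⟨w⟩, ⟨PullbackCone.IsLimit.mk w l hl₁ hl₂ fun s m h₁ h₂ ↦
    hom_ext_of_presentable κ fun T hT t ↦ hom_ext hT _ _ ?_ ?_⟩⟩
  · simp [h₁, hl₁]
  · simp [h₂, hl₂]

/-- The hypotheses say that `Hom(T, -)` sends `c` to a colimit of sets for each `κ`-presentable `T`.
A map out of `c.pt` is defined on each `T` by choosing a stage; `aux` shows that the choice is
immaterial. -/
lemma isColimit_of_presentable {J : Type*} [Category* J] [IsFiltered J] {F : J ⥤ A} (c : Cocone F)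
    (exists_fac : ∀ ⦃T : A⦄ (_ : isCardinalPresentable A κ T) (t : T ⟶ c.pt),
      ∃ (j : J) (t' : T ⟶ F.obj j), t' ≫ c.ι.app j = t)
    (exists_eq : ∀ ⦃T : A⦄ (_ : isCardinalPresentable A κ T) (j : J) (t t' : T ⟶ F.obj j),
      t ≫ c.ι.app j = t' ≫ c.ι.app j → ∃ (k : J) (a : j ⟶ k), t ≫ F.map a = t' ≫ F.map a) :
    Nonempty (IsColimit c) := by
  have aux (s : Cocone F) ⦃T : A⦄ (hT : isCardinalPresentable A κ T) {j j' : J} (t : T ⟶ F.obj j)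
      (t' : T ⟶ F.obj j') (h : t ≫ c.ι.app j = t' ≫ c.ι.app j') :
      t ≫ s.ι.app j = t' ≫ s.ι.app j' := by
    obtain ⟨k, a, hk⟩ := exists_eq hT (IsFiltered.max j j')
      (t ≫ F.map (IsFiltered.leftToMax j j')) (t' ≫ F.map (IsFiltered.rightToMax j j'))
      (by simpa using h)
    simpa using hk =≫ s.ι.app k
  have key (s : Cocone F) : ∃ m : c.pt ⟶ s.pt, ∀ j, c.ι.app j ≫ m = s.ι.app j := by
    choose j φ hφ using exists_fac
    obtain ⟨m, hm⟩ := exists_hom_of_presentable κ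
      (fun T (hT : isCardinalPresentable A κ T) t ↦ φ hT t ≫ s.ι.app _) (fun T T' hT hT' f t ↦ by
        rw [← Category.assoc]
        exact aux s hT _ _ (by simp [hφ]))
    refine ⟨m, fun i ↦ hom_ext_of_presentable κ fun T hT t ↦ ?_⟩
    rw [← Category.assoc, hm hT]
    exact aux s hT _ _ (hφ _ _)
  choose m hm using key
  refine ⟨⟨m, hm, fun s m' h ↦ hom_ext_of_presentable κ fun T hT t ↦ ?_⟩⟩
  obtain ⟨j, t', rfl⟩ := exists_fac hT t
  simp [h, hm]

/-- The inclusion of the `κ`-presentable objects preserves pullback squares. -/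
lemma isPullback_hom {P X Y Z : Presentables A κ} {fst : P ⟶ X} {snd : P ⟶ Y} {f : X ⟶ Z}
    {g : Y ⟶ Z} (h : IsPullback fst snd f g) : IsPullback fst.hom snd.hom f.hom g.hom :=
  isPullback_of_presentable κ congr(($h.w).hom)
    (fun T hT a b hab ↦ by
      let a' : (⟨T, hT⟩ : Presentables A κ) ⟶ X := ObjectProperty.homMk a
      let b' : (⟨T, hT⟩ : Presentables A κ) ⟶ Y := ObjectProperty.homMk b
      have w : a' ≫ f = b' ≫ g := ObjectProperty.hom_ext _ hab
      exact ⟨(h.lift a' b' w).hom, congr($(h.lift_fst a' b' w).hom),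
        congr($(h.lift_snd a' b' w).hom)⟩)
    (fun T hT l l' h₁ h₂ ↦ by
      let l₁ : (⟨T, hT⟩ : Presentables A κ) ⟶ P := ObjectProperty.homMk l
      let l₂ : (⟨T, hT⟩ : Presentables A κ) ⟶ P := ObjectProperty.homMk l'
      have : l₁ = l₂ := h.hom_ext (ObjectProperty.hom_ext _ h₁) (ObjectProperty.hom_ext _ h₂)
      exact congr($(this).hom))

end Density

end QE

namespace QE

/-! ### Arrows of `Q` viewed in `A` -/

section Extend

variable {A : Type u} [Category.{v} A] {κ : Cardinal.{w}} [Fact κ.IsRegular]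
  {Q : MorphismProperty (Presentables A κ)}

lemma extend_hom {X Y : Presentables A κ} {f : X ⟶ Y} (hf : Q f) : extend κ Q f.hom :=
  ⟨X.property, Y.property, hf⟩

lemma extend_id (hQ : IsQEEpiClass Q) {X : A} (hX : isCardinalPresentable A κ X) :
    extend κ Q (𝟙 X) :=
  ⟨hX, hX, hQ.id_mem _⟩

lemma extend_comp (hQ : IsQEEpiClass Q) {X Y Z : A} {f : X ⟶ Y} {g : Y ⟶ Z}
    (hf : extend κ Q f) (hg : extend κ Q g) : extend κ Q (f ≫ g) := by
  obtain ⟨hX, hY, hf⟩ := hf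
  obtain ⟨_, hZ, hg⟩ := hg
  exact ⟨hX, hZ, hQ.comp_mem _ _ hf hg⟩

lemma extend_of_comp (hQ : IsStrongQEEpiClass Q) {X Y Z : A} {q : X ⟶ Y} {p : Y ⟶ Z}
    (hY : isCardinalPresentable A κ Y) (h : extend κ Q (q ≫ p)) : extend κ Q p := by
  obtain ⟨hX, hZ, h⟩ := h
  exact ⟨hY, hZ, hQ.of_comp (ObjectProperty.homMk q : (⟨X, hX⟩ : Presentables A κ) ⟶ ⟨Y, hY⟩) _ h⟩

variable [IsCardinalAccessibleCategory A κ]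

lemma exists_isPullback_extend (hQ : IsQEEpiClass Q) {D E E' : A} {q : D ⟶ E} (hq : extend κ Q q)
    (f : E' ⟶ E) (hE' : isCardinalPresentable A κ E') :
    ∃ (D' : A) (f' : D' ⟶ D) (q' : D' ⟶ E'), IsPullback f' q' q f ∧ extend κ Q q' := by
  obtain ⟨hD, hE, hq⟩ := hq
  let f₀ : (⟨E', hE'⟩ : Presentables A κ) ⟶ ⟨E, hE⟩ := ObjectProperty.homMk f
  let q₀ : (⟨D, hD⟩ : Presentables A κ) ⟶ ⟨E, hE⟩ := ObjectProperty.homMk q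
  have := hQ.hasPullback q₀ f₀ hq
  have h := IsPullback.of_hasPullback q₀ f₀
  exact ⟨_, _, _, isPullback_hom κ h, extend_hom (hQ.stable h hq)⟩

lemma exists_kernelPair_extend (hQ : IsQEEpiClass Q) {D E : A} {q : D ⟶ E} (hq : extend κ Q q) :
    ∃ (K : A) (k₁ k₂ : K ⟶ D), isCardinalPresentable A κ K ∧ IsKernelPair q k₁ k₂ := by
  obtain ⟨K, k₁, k₂, h, hk⟩ := exists_isPullback_extend hQ hq q hq.1
  exact ⟨K, k₁, k₂, hk.1, h⟩

/-- The axioms on `Q` only concern `κ`-presentable targets. Since the `κ`-presentable objects over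
`Z` form a filtered category, `u` and `v` factor through one such object in such a way that the
factors already agree after composition with `q`. -/
lemma extend_epi (hQ : IsQEEpiClass Q) {D E : A} {q : D ⟶ E} (hq : extend κ Q q) : Epi q where
  left_cancellation {Z} u v huv := by
    obtain ⟨hD, hE, hq⟩ := hq
    let J := CostructuredArrow (isCardinalPresentable A κ).ι Z
    let D₀ : Presentables A κ := ⟨D, hD⟩
    let E₀ : Presentables A κ := ⟨E, hE⟩
    let q₀ : D₀ ⟶ E₀ := ObjectProperty.homMk q
    have := isFiltered_of_isCardinalFiltered J κ
    let x : J := CostructuredArrow.mk (Y := D₀) (q ≫ u)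
    let y : J := CostructuredArrow.mk (Y := E₀) u
    let y' : J := CostructuredArrow.mk (Y := E₀) v
    let a : x ⟶ y := CostructuredArrow.homMk q₀
    let b : x ⟶ y' := CostructuredArrow.homMk q₀ huv.symm
    obtain ⟨t, f, g, h⟩ := IsFiltered.span a b
    have hq' := hQ.hasPullback q₀ q₀ hq
    have hepi := Cofork.IsColimit.epi
      (hQ.coequalizer (IsPullback.of_hasPullback q₀ q₀) hq).some
    have h' : f.left = g.left := hepi.left_cancellation _ _ congr(($h).left)
    have h₁ : f.left.hom ≫ t.hom = u := CostructuredArrow.w f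
    have h₂ : g.left.hom ≫ t.hom = v := CostructuredArrow.w g
    rw [← h₁, ← h₂, h']

/-- A morphism belonging to `extend κ Q` is the coequalizer of its kernel pair. -/
lemma exists_desc_extend (hQ : IsQEEpiClass Q) {D E K Z : A} {q : D ⟶ E} (hq : extend κ Q q)
    {k₁ k₂ : K ⟶ D} (hK : isCardinalPresentable A κ K) (hk : IsKernelPair q k₁ k₂)
    (h : D ⟶ Z) (hh : k₁ ≫ h = k₂ ≫ h) : ∃ u : E ⟶ Z, q ≫ u = h := by
  obtain ⟨hD, hE, hq⟩ := hq
  let J := CostructuredArrow (isCardinalPresentable A κ).ι Z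
  let D₀ : Presentables A κ := ⟨D, hD⟩
  let E₀ : Presentables A κ := ⟨E, hE⟩
  let K₀ : Presentables A κ := ⟨K, hK⟩
  let q₀ : D₀ ⟶ E₀ := ObjectProperty.homMk q
  let k₁' : K₀ ⟶ D₀ := ObjectProperty.homMk k₁
  let k₂' : K₀ ⟶ D₀ := ObjectProperty.homMk k₂
  have := isFiltered_of_isCardinalFiltered J κ
  let x : J := CostructuredArrow.mk (Y := K₀) (k₁ ≫ h)
  let y : J := CostructuredArrow.mk (Y := D₀) h
  let a : x ⟶ y := CostructuredArrow.homMk k₁'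
  let b : x ⟶ y := CostructuredArrow.homMk k₂' hh.symm
  have hc := (hQ.coequalizer (isPullback_of_hom hk : IsPullback k₁' k₂' q₀ q₀) hq).some
  -- Coequalizing `k₁` and `k₂` over `Z` factors `h` through a `κ`-presentable object where the
  -- first factor already coequalizes them, so the universal property inside the subcategory
  -- applies.
  obtain ⟨l, hl⟩ := Cofork.IsColimit.desc' hc (IsFiltered.coeqHom a b).left
    congr(($(IsFiltered.coeq_condition a b)).left)
  have hl' : q ≫ l.hom = (IsFiltered.coeqHom a b).left.hom := congr(($hl).hom)
  have h₁ : (IsFiltered.coeqHom a b).left.hom ≫ (IsFiltered.coeq a b).hom = h :=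
    CostructuredArrow.w (IsFiltered.coeqHom a b)
  exact ⟨l.hom ≫ (IsFiltered.coeq a b).hom, by rw [← Category.assoc, hl', h₁]⟩

end Extend

/-! ### The factorization criterion and its closure properties -/

section Lifts

variable {A : Type u} [Category.{v} A] (κ : Cardinal.{w}) [Fact κ.IsRegular]

/-- The class of morphisms `p` such that every morphism to `p` from a morphism between
`κ`-presentable objects factors through a morphism from `W` with the same codomain. -/
def HasLifts (W : MorphismProperty A) : MorphismProperty A := fun D E p =>
  ∀ ⦃G H : A⦄ (_ : isCardinalPresentable A κ G) (_ : isCardinalPresentable A κ H)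
    (g : G ⟶ H) (a : G ⟶ D) (b : H ⟶ E), a ≫ p = g ≫ b →
    ∃ (D' : A) (q : D' ⟶ H) (s : G ⟶ D') (t : D' ⟶ D),
      W q ∧ s ≫ q = g ∧ s ≫ t = a ∧ t ≫ p = q ≫ b

variable {κ} {Q : MorphismProperty (Presentables A κ)}

/-- Factoring the identity of `p` through some `q` in `Q` gives `t ≫ p = q`, and the strong axiom
yields `p`. -/
lemma extend_of_hasLifts (hQ : IsStrongQEEpiClass Q) {D E : A} {p : D ⟶ E}
    (hp : HasLifts κ (extend κ Q) p) (hD : isCardinalPresentable A κ D)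
    (hE : isCardinalPresentable A κ E) : extend κ Q p := by
  obtain ⟨D', q, _, t, hq, _, _, h⟩ := hp hD hE p (𝟙 D) (𝟙 E) (by simp)
  exact extend_of_comp hQ (q := t) hD (by simpa [h] using hq)

lemma hasLifts_stable {D E D' E' : A} {W : MorphismProperty A} {p : D ⟶ E} {f : E' ⟶ E}
    {f' : D' ⟶ D} {p' : D' ⟶ E'} (h : IsPullback f' p' p f) (hp : HasLifts κ W p) :
    HasLifts κ W p' := by
  intro G H hG hH g a b w
  obtain ⟨X, q, s, t, hq, h₁, h₂, h₃⟩ := hp hG hH g (a ≫ f') (b ≫ f)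
    (by simp [h.w, reassoc_of% w])
  exact ⟨X, q, s, h.lift t (q ≫ b) (by simpa using h₃), hq, h₁,
    h.hom_ext (by simpa) (by simp [reassoc_of% h₁, w]), by simp⟩

lemma hasLifts_id (hQ : IsQEEpiClass Q) (X : A) : HasLifts κ (extend κ Q) (𝟙 X) :=
  fun _ H _ hH g a b w ↦ ⟨H, 𝟙 H, g, b, extend_id hQ hH, by simp, by simpa using w.symm, by simp⟩

lemma hasLifts_comp (hQ : IsQEEpiClass Q) {X Y Z : A} {f : X ⟶ Y} {g : Y ⟶ Z}
    (hf : HasLifts κ (extend κ Q) f) (hg : HasLifts κ (extend κ Q) g) :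
    HasLifts κ (extend κ Q) (f ≫ g) := by
  intro G H hG hH r a b w
  obtain ⟨Y', q, s, t, hq, rfl, h₂, h₃⟩ := hg hG hH r (a ≫ f) b (by simpa using w)
  obtain ⟨X', q', s', t', hq', rfl, rfl, h₃'⟩ := hf hG hq.1 s a t h₂.symm
  exact ⟨X', q' ≫ q, s', t', extend_comp hQ hq' hq, by simp, rfl, by simp [reassoc_of% h₃', h₃]⟩

lemma isCardinalPresentable_initial [LocallySmall.{w} A] [HasFiniteCoproducts A] :
    isCardinalPresentable A κ (⊥_ A) := by
  have : ∀ k, IsCardinalPresentable ((Functor.empty.{0} A).obj k) κ := fun k ↦ k.as.elim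
  refine isCardinalPresentable_of_isColimit _ (colimit.isColimit (Functor.empty.{0} A)) κ ?_
  exact .of_le (by rw [hasCardinalLT_aleph0_iff]; infer_instance)
    (Cardinal.IsRegular.aleph0_le Fact.out)

lemma isCardinalPresentable_coprod [LocallySmall.{w} A] [HasFiniteCoproducts A] {X Y : A}
    (hX : isCardinalPresentable A κ X) (hY : isCardinalPresentable A κ Y) :
    isCardinalPresentable A κ (X ⨿ Y) := by
  have : ∀ k, IsCardinalPresentable ((pair X Y).obj k) κ := by
    rintro ⟨_ | _⟩
    exacts [hX, hY]
  refine isCardinalPresentable_of_isColimit _ (colimit.isColimit (pair X Y)) κ ?_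
  exact .of_le (by rw [hasCardinalLT_aleph0_iff]; infer_instance)
    (Cardinal.IsRegular.aleph0_le Fact.out)

/-- Only `b` is lifted, from the initial arrow to `H`, since `a` need not factor through `X`. The
object `G` is then added as a summand; the enlarged arrow stays in `Q` by the strong axiom, as its
restriction to `X'` is `q'`. -/
lemma hasLifts_of_comp [LocallySmall.{w} A] [HasFiniteCoproducts A] (hQ : IsStrongQEEpiClass Q)
    {X Y Z : A} {q : X ⟶ Y} {p : Y ⟶ Z} (h : HasLifts κ (extend κ Q) (q ≫ p)) :
    HasLifts κ (extend κ Q) p := by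
  intro G H hG hH g a b w
  obtain ⟨X', q', s, t, hq', _, _, h₃⟩ :=
    h isCardinalPresentable_initial hH (initial.to H) (initial.to X) b (by simp)
  have h₁ : coprod.inl ≫ coprod.desc q' g = q' := coprod.inl_desc _ _
  have h₂ : coprod.inr ≫ coprod.desc q' g = g := coprod.inr_desc _ _
  have h₄ : coprod.inl ≫ coprod.desc (t ≫ q) a = t ≫ q := coprod.inl_desc _ _
  have h₅ : coprod.inr ≫ coprod.desc (t ≫ q) a = a := coprod.inr_desc _ _
  refine ⟨X' ⨿ G, coprod.desc q' g, coprod.inr, coprod.desc (t ≫ q) a,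
    extend_of_comp hQ (q := coprod.inl) (isCardinalPresentable_coprod hq'.1 hG) (by rwa [h₁]),
    h₂, h₅, coprod.hom_ext ?_ ?_⟩
  · rw [reassoc_of% h₁, reassoc_of% h₄, h₃]
  · rw [reassoc_of% h₂, reassoc_of% h₅, w]

variable [IsCardinalAccessibleCategory A κ]

lemma hasLifts_of_extend (hQ : IsQEEpiClass Q) {D E : A} {p : D ⟶ E} (hp : extend κ Q p) :
    HasLifts κ (extend κ Q) p := by
  intro G H hG hH g a b w
  obtain ⟨D', b', q, h, hq⟩ := exists_isPullback_extend hQ hp b hH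
  exact ⟨D', q, h.lift a g w, b', hq, by simp, by simp, h.w⟩

end Lifts

end QE

namespace QE

/-! ### Directed colimits of arrows and of pullback squares -/

section Colimits

variable {A : Type u} [Category.{v} A] {κ : Cardinal.{w}} [Fact κ.IsRegular]
  {Q : MorphismProperty (Presentables A κ)}

lemma directedColimitsHom.exists_presentation {W : MorphismProperty A} {D E : A} {p : D ⟶ E}
    (hp : directedColimitsHom κ W p) :
    ∃ (J : Type w) (_ : PartialOrder J) (_ : IsCardinalFiltered J κ) (X₁ X₂ : J ⥤ A)
      (c₁ : X₁ ⟶ (Functor.const J).obj D) (c₂ : X₂ ⟶ (Functor.const J).obj E) (f : X₁ ⟶ X₂),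
      Nonempty (IsColimit (Cocone.mk D c₁)) ∧ Nonempty (IsColimit (Cocone.mk E c₂)) ∧
      (∀ j, W (f.app j)) ∧ ∀ j, c₁.app j ≫ p = f.app j ≫ c₂.app j := by
  obtain ⟨J, _, _, ⟨X₁, X₂, c₁, c₂, h₁, h₂, f, hf⟩⟩ := hp
  exact ⟨J, _, inferInstance, X₁, X₂, c₁.ι, c₂.ι, f, ⟨h₁⟩, ⟨h₂⟩, hf, fun j ↦ h₁.fac _ j⟩

/-- A `κ`-filtered essentially small category receives a final functor from a `κ`-directed poset, so
index categories need not be posets. -/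
lemma directedColimitsHom_of_isColimit {W : MorphismProperty A} {J : Type*} [Category* J]
    [EssentiallySmall.{w} J] [IsCardinalFiltered J κ]
    {X₁ X₂ : J ⥤ A} {c₁ : Cocone X₁} {c₂ : Cocone X₂} (h₁ : IsColimit c₁) (h₂ : IsColimit c₂)
    (f : X₁ ⟶ X₂) (hf : ∀ j, W (f.app j)) (p : c₁.pt ⟶ c₂.pt)
    (hp : ∀ j, c₁.ι.app j ≫ p = f.app j ≫ c₂.ι.app j) : directedColimitsHom κ W p := by
  have := IsCardinalFiltered.of_equivalence κ (equivSmallModel.{w} J)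
  obtain ⟨α, _, _, F, _⟩ := IsCardinalFiltered.exists_cardinal_directed (SmallModel.{w} J) κ
  exact ⟨α, inferInstance, inferInstance,
    W.colimitsOfShape_le_of_final (F ⋙ (equivSmallModel.{w} J).inverse) _
      (.mk' X₁ X₂ c₁ c₂ h₁ h₂ f hf p hp)⟩

section

variable {T : A} (hT : isCardinalPresentable A κ T) {J : Type w} [PartialOrder J]
  [IsCardinalFiltered J κ]
include hT

lemma exists_pair_of_isColimit {X Y : J ⥤ A} {cX : Cocone X} {cY : Cocone Y} (hX : IsColimit cX)
    (hY : IsColimit cY) (x : T ⟶ cX.pt) (y : T ⟶ cY.pt) :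
    ∃ (j : J) (x' : T ⟶ X.obj j) (y' : T ⟶ Y.obj j), x' ≫ cX.ι.app j = x ∧ y' ≫ cY.ι.app j = y := by
  have := isFiltered_of_isCardinalFiltered J κ
  have : IsCardinalPresentable T κ := hT
  obtain ⟨i, x', rfl⟩ := IsCardinalPresentable.exists_hom_of_isColimit κ hX x
  obtain ⟨j, y', rfl⟩ := IsCardinalPresentable.exists_hom_of_isColimit κ hY y
  exact ⟨IsFiltered.max i j, x' ≫ X.map (IsFiltered.leftToMax i j),
    y' ≫ Y.map (IsFiltered.rightToMax i j), by simp, by simp⟩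

lemma exists_eq_pair_of_isColimit {X Y : J ⥤ A} {cX : Cocone X} {cY : Cocone Y}
    (hX : IsColimit cX) (hY : IsColimit cY) {j : J} (x x' : T ⟶ X.obj j) (y y' : T ⟶ Y.obj j)
    (hx : x ≫ cX.ι.app j = x' ≫ cX.ι.app j) (hy : y ≫ cY.ι.app j = y' ≫ cY.ι.app j) :
    ∃ (k : J) (f : j ⟶ k), x ≫ X.map f = x' ≫ X.map f ∧ y ≫ Y.map f = y' ≫ Y.map f := by
  have : IsCardinalPresentable T κ := hT
  obtain ⟨i, f, hf⟩ := IsCardinalPresentable.exists_eq_of_isColimit' κ hX x x' hx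
  obtain ⟨k, g, hg⟩ := IsCardinalPresentable.exists_eq_of_isColimit' κ hY (y ≫ Y.map f)
    (y' ≫ Y.map f) (by simpa)
  exact ⟨k, f ≫ g, by simp [reassoc_of% hf], by simpa using hg⟩

end

lemma lim_hasLifts [IsCardinalAccessibleCategory A κ] (hQ : IsQEEpiClass Q) {D E : A} {p : D ⟶ E}
    (hp : lim κ Q p) : HasLifts κ (extend κ Q) p := by
  obtain ⟨J, _, _, X₁, X₂, c₁, c₂, f, ⟨h₁⟩, ⟨h₂⟩, hf, hp⟩ := hp.exists_presentation
  intro G H hG hH g a b w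
  have : IsCardinalPresentable G κ := hG
  have : IsCardinalPresentable H κ := hH
  have := isFiltered_of_isCardinalFiltered J κ
  obtain ⟨i, a, rfl⟩ := IsCardinalPresentable.exists_hom_of_isColimit κ h₁ a
  obtain ⟨j, b, rfl⟩ := IsCardinalPresentable.exists_hom_of_isColimit κ h₂ b
  dsimp at w
  obtain ⟨k, u, v, huv⟩ := IsCardinalPresentable.exists_eq_of_isColimit κ h₂ (a ≫ f.app i)
    (g ≫ b) (by simpa [hp] using w)
  obtain ⟨D', q, s, t, hq, rfl, h₂, h₃⟩ := hasLifts_of_extend hQ (hf k) hG hH g (a ≫ X₁.map u)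
    (b ≫ X₂.map v) (by simpa using huv)
  exact ⟨D', q, s, t ≫ c₁.app k, hq, rfl, by simp [reassoc_of% h₂], by simp [hp, reassoc_of% h₃]⟩

/-- A morphism in `lim κ Q` is the coequalizer of its kernel pair. -/
lemma exists_desc_lim [IsCardinalAccessibleCategory A κ] (hQ : IsQEEpiClass Q) {D E : A}
    {p : D ⟶ E} (hp : lim κ Q p) {Z : A} (h : D ⟶ Z)
    (hh : ∀ {T : A} (t₁ t₂ : T ⟶ D), t₁ ≫ p = t₂ ≫ p → t₁ ≫ h = t₂ ≫ h) :
    ∃ u : E ⟶ Z, p ≫ u = h := by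
  obtain ⟨J, _, _, X₁, X₂, c₁, c₂, f, ⟨h₁⟩, ⟨h₂⟩, hf, hp⟩ := hp.exists_presentation
  have key (j : J) : ∃ u : X₂.obj j ⟶ Z, f.app j ≫ u = c₁.app j ≫ h := by
    obtain ⟨K, k₁, k₂, hK, hk⟩ := exists_kernelPair_extend hQ (hf j)
    exact exists_desc_extend hQ (hf j) hK hk _
      (by simpa using hh (k₁ ≫ c₁.app j) (k₂ ≫ c₁.app j) (by simp [hp, hk.w_assoc]))
  choose u hu using key
  let s : Cocone X₂ :=
    { pt := Z
      ι.app := u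
      ι.naturality i j g := by
        -- The maps `u j` were chosen independently; they are compatible because each `f.app i` is
        -- an epimorphism.
        have := extend_epi hQ (hf i)
        rw [← cancel_epi (f.app i)]
        have := c₁.naturality g
        dsimp at this ⊢
        rw [Category.comp_id] at this
        rw [Category.comp_id, hu, ← NatTrans.naturality_assoc, hu, reassoc_of% this] }
  refine ⟨h₂.desc s, h₁.hom_ext fun j ↦ ?_⟩
  have := h₂.fac s j
  dsimp at this ⊢
  rw [reassoc_of% hp j, this]
  exact hu j

lemma epi_of_lim [IsCardinalAccessibleCategory A κ] (hQ : IsQEEpiClass Q) {D E : A}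
    {p : D ⟶ E} (hp : lim κ Q p) : Epi p where
  left_cancellation {Z} u v huv := by
    obtain ⟨J, _, _, X₁, X₂, c₁, c₂, f, ⟨h₁⟩, ⟨h₂⟩, hf, hp⟩ := hp.exists_presentation
    refine h₂.hom_ext fun j ↦ ?_
    have := extend_epi hQ (hf j)
    simp [← cancel_epi (f.app j), ← reassoc_of% hp j, huv]

section

variable {J : Type w} [PartialOrder J] {P X Y Z : J ⥤ A}
  {fst : P ⟶ X} {snd : P ⟶ Y} {f : X ⟶ Z} {g : Y ⟶ Z}
  {cP : Cocone P} {cX : Cocone X} {cY : Cocone Y} {cZ : Cocone Z}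
  {fst' : cP.pt ⟶ cX.pt} {snd' : cP.pt ⟶ cY.pt} {f' : cX.pt ⟶ cZ.pt} {g' : cY.pt ⟶ cZ.pt}

/-- With `exists_eq_of_isColimit_pullback`, this is the commutation of filtered colimits with
pullbacks in sets, applied to `Hom(T, -)`. -/
lemma exists_lift_of_isColimit [IsCardinalFiltered J κ]
    (h : ∀ j, IsPullback (fst.app j) (snd.app j) (f.app j) (g.app j))
    (hX : IsColimit cX) (hY : IsColimit cY) (hZ : IsColimit cZ)
    (hfst : ∀ j, cP.ι.app j ≫ fst' = fst.app j ≫ cX.ι.app j)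
    (hsnd : ∀ j, cP.ι.app j ≫ snd' = snd.app j ≫ cY.ι.app j)
    (hf : ∀ j, cX.ι.app j ≫ f' = f.app j ≫ cZ.ι.app j)
    (hg : ∀ j, cY.ι.app j ≫ g' = g.app j ≫ cZ.ι.app j)
    {T : A} (hT : isCardinalPresentable A κ T) (x : T ⟶ cX.pt) (y : T ⟶ cY.pt)
    (w : x ≫ f' = y ≫ g') : ∃ (j : J) (l : T ⟶ P.obj j),
      l ≫ cP.ι.app j ≫ fst' = x ∧ l ≫ cP.ι.app j ≫ snd' = y := by
  have : IsCardinalPresentable T κ := hT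
  obtain ⟨j, x, y, rfl, rfl⟩ := exists_pair_of_isColimit hT hX hY x y
  obtain ⟨k, u, hu⟩ := IsCardinalPresentable.exists_eq_of_isColimit' κ hZ (x ≫ f.app j)
    (y ≫ g.app j) (by simpa [hf, hg] using w)
  have hl₁ := (h k).lift_fst (x ≫ X.map u) (y ≫ Y.map u) (by simpa using hu)
  have hl₂ := (h k).lift_snd (x ≫ X.map u) (y ≫ Y.map u) (by simpa using hu)
  exact ⟨k, (h k).lift (x ≫ X.map u) (y ≫ Y.map u) (by simpa using hu),
    by simp [hfst], by simp [hsnd]⟩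

lemma exists_eq_of_isColimit_pullback [IsCardinalFiltered J κ]
    (h : ∀ j, IsPullback (fst.app j) (snd.app j) (f.app j) (g.app j))
    (hX : IsColimit cX) (hY : IsColimit cY)
    (hfst : ∀ j, cP.ι.app j ≫ fst' = fst.app j ≫ cX.ι.app j)
    (hsnd : ∀ j, cP.ι.app j ≫ snd' = snd.app j ≫ cY.ι.app j)
    {T : A} (hT : isCardinalPresentable A κ T) {j : J} (l l' : T ⟶ P.obj j)
    (h₁ : l ≫ cP.ι.app j ≫ fst' = l' ≫ cP.ι.app j ≫ fst')
    (h₂ : l ≫ cP.ι.app j ≫ snd' = l' ≫ cP.ι.app j ≫ snd') :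
    ∃ (k : J) (a : j ⟶ k), l ≫ P.map a = l' ≫ P.map a := by
  obtain ⟨k, a, h₁, h₂⟩ := exists_eq_pair_of_isColimit hT hX hY (l ≫ fst.app j) (l' ≫ fst.app j)
    (l ≫ snd.app j) (l' ≫ snd.app j) (by simpa [hfst] using h₁) (by simpa [hsnd] using h₂)
  exact ⟨k, a, (h k).hom_ext (by simpa using h₁) (by simpa using h₂)⟩

/-- `κ`-directed colimits of pullback squares are pullback squares. -/
lemma isPullback_of_isColimit (κ : Cardinal.{w}) [Fact κ.IsRegular]
    [IsCardinalAccessibleCategory A κ] [IsCardinalFiltered J κ]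
    (h : ∀ j, IsPullback (fst.app j) (snd.app j) (f.app j) (g.app j))
    (hP : IsColimit cP) (hX : IsColimit cX) (hY : IsColimit cY) (hZ : IsColimit cZ)
    (hfst : ∀ j, cP.ι.app j ≫ fst' = fst.app j ≫ cX.ι.app j)
    (hsnd : ∀ j, cP.ι.app j ≫ snd' = snd.app j ≫ cY.ι.app j)
    (hf : ∀ j, cX.ι.app j ≫ f' = f.app j ≫ cZ.ι.app j)
    (hg : ∀ j, cY.ι.app j ≫ g' = g.app j ≫ cZ.ι.app j) : IsPullback fst' snd' f' g' := by
  refine isPullback_of_presentable κ (hP.hom_ext fun j ↦ ?_) (fun T hT x y w ↦ ?_)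
    (fun T hT l l' h₁ h₂ ↦ ?_)
  · simp [reassoc_of% hfst j, hf, reassoc_of% hsnd j, hg, (h j).w_assoc]
  · obtain ⟨j, l, h₁, h₂⟩ := exists_lift_of_isColimit h hX hY hZ hfst hsnd hf hg hT x y w
    exact ⟨l ≫ cP.ι.app j, by simpa using h₁, by simpa using h₂⟩
  · obtain ⟨j, l, l', rfl, rfl⟩ := exists_pair_of_isColimit hT hP hP l l'
    obtain ⟨k, a, hk⟩ := exists_eq_of_isColimit_pullback h hX hY hfst hsnd hT l l'
      (by simpa using h₁) (by simpa using h₂)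
    simpa using hk =≫ cP.ι.app k

lemma isColimit_of_isPullback (κ : Cardinal.{w}) [Fact κ.IsRegular]
    [IsCardinalAccessibleCategory A κ] [IsCardinalFiltered J κ]
    (h : ∀ j, IsPullback (fst.app j) (snd.app j) (f.app j) (g.app j))
    (hX : IsColimit cX) (hY : IsColimit cY) (hZ : IsColimit cZ)
    (hfst : ∀ j, cP.ι.app j ≫ fst' = fst.app j ≫ cX.ι.app j)
    (hsnd : ∀ j, cP.ι.app j ≫ snd' = snd.app j ≫ cY.ι.app j)
    (hf : ∀ j, cX.ι.app j ≫ f' = f.app j ≫ cZ.ι.app j)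
    (hg : ∀ j, cY.ι.app j ≫ g' = g.app j ≫ cZ.ι.app j) (h' : IsPullback fst' snd' f' g') :
    Nonempty (IsColimit cP) := by
  have := isFiltered_of_isCardinalFiltered J κ
  refine isColimit_of_presentable κ _ (fun T hT t ↦ ?_) (fun T hT j l l' hl ↦
    exists_eq_of_isColimit_pullback h hX hY hfst hsnd hT l l'
      (by simp [reassoc_of% hl]) (by simp [reassoc_of% hl]))
  obtain ⟨j, l, h₁, h₂⟩ := exists_lift_of_isColimit h hX hY hZ hfst hsnd hf hg hT
    (t ≫ fst') (t ≫ snd') (by simp [h'.w])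
  exact ⟨j, l, h'.hom_ext (by simpa) (by simpa)⟩

end

end Colimits

end QE

namespace QE

variable {A : Type u} [Category.{v} A] {κ : Cardinal.{w}} [Fact κ.IsRegular]
  {Q : MorphismProperty (Presentables A κ)}

/-! ### From the criterion to a colimit presentation -/

section FactorizationIndex

variable (κ) in
/-- The category of morphisms from morphisms between `κ`-presentable objects to a morphism `p`. -/
abbrev PresentableArrows {D E : A} (p : D ⟶ E) :=
  Comma (CostructuredArrow.map (S := (isCardinalPresentable A κ).ι) p) (𝟭 _)

/-- The objects of `PresentableArrows κ p` given by morphisms in the class `Q`. -/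
def PresentableArrows.mem (Q : MorphismProperty (Presentables A κ)) {D E : A} (p : D ⟶ E) :
    ObjectProperty (PresentableArrows κ p) := fun c ↦ Q c.hom.left

instance [IsCardinalAccessibleCategory A κ] {D E : A} (p : D ⟶ E) :
    EssentiallySmall.{w} (PresentableArrows κ p) :=
  essentiallySmall_comma _ _

instance [IsCardinalAccessibleCategory A κ] {D E : A} (p : D ⟶ E) :
    IsCardinalFiltered (PresentableArrows κ p) κ :=
  isCardinalFiltered_comma_id _

/-- The criterion is exactly cofinality of the arrows of `Q` in `PresentableArrows κ p`. -/
lemma HasLifts.exists_hom {D E : A} {p : D ⟶ E} (hp : HasLifts κ (extend κ Q) p)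
    (c : PresentableArrows κ p) :
    ∃ c' : (PresentableArrows.mem Q p).FullSubcategory, Nonempty (c ⟶ c'.obj) := by
  have w : c.left.hom ≫ p = c.hom.left.hom ≫ c.right.hom := (CostructuredArrow.w c.hom).symm
  obtain ⟨D', q, s, t, ⟨hD', hE', hq⟩, h₁, h₂, h₃⟩ :=
    hp c.left.left.property c.right.left.property c.hom.left.hom c.left.hom c.right.hom w
  let D₀ : Presentables A κ := ⟨D', hD'⟩
  let q₀ : D₀ ⟶ c.right.left := ObjectProperty.homMk q
  let s₀ : c.left.left ⟶ D₀ := ObjectProperty.homMk s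
  let c' : PresentableArrows κ p :=
    { left := CostructuredArrow.mk (Y := D₀) t
      right := c.right
      hom := CostructuredArrow.homMk q₀ h₃.symm }
  exact ⟨⟨c', hq⟩, ⟨{
    left := CostructuredArrow.homMk s₀ h₂
    right := 𝟙 _
    w := by
      ext
      exact h₁.trans (Category.comp_id _).symm }⟩⟩

end FactorizationIndex

lemma lim_of_hasLifts [IsCardinalAccessibleCategory A κ] {D E : A} {p : D ⟶ E}
    (hp : HasLifts κ (extend κ Q) p) : lim κ Q p := by
  let ι := (PresentableArrows.mem Q p).ι
  have : IsCardinalFiltered (PresentableArrows.mem Q p).FullSubcategory κ :=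
    isCardinalFiltered_of_fullyFaithful ι hp.exists_hom
  have : EssentiallySmall.{w} (PresentableArrows.mem Q p).FullSubcategory :=
    essentiallySmall_of_fully_faithful ι
  have := isFiltered_of_isCardinalFiltered (PresentableArrows κ p) κ
  have := isFiltered_of_isCardinalFiltered
    (CostructuredArrow (isCardinalPresentable A κ).ι D) κ
  have := isFiltered_of_isCardinalFiltered
    (CostructuredArrow (isCardinalPresentable A κ).ι E) κ
  have : ι.Final := Functor.final_of_exists_of_isFiltered_of_fullyFaithful ι hp.exists_hom
  let f : ι ⋙ Comma.fst _ _ ⋙ CostructuredArrow.proj _ _ ⋙ (isCardinalPresentable A κ).ι ⟶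
      ι ⋙ Comma.snd _ _ ⋙ CostructuredArrow.proj _ _ ⋙ (isCardinalPresentable A κ).ι :=
    { app j := j.obj.hom.left.hom
      naturality i j g := congr(($(g.hom.w).left).hom) }
  -- Both projections to the canonical diagrams of `D` and `E` are final, so density gives the two
  -- colimits.
  exact directedColimitsHom_of_isColimit
    ((Functor.Final.isColimitWhiskerEquiv (ι ⋙ Comma.fst _ _) _).symm
      ((isCardinalPresentable A κ).ι.denseAt D))
    ((Functor.Final.isColimitWhiskerEquiv (ι ⋙ Comma.snd _ _) _).symm
      ((isCardinalPresentable A κ).ι.denseAt E)) f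
    (fun j ↦ extend_hom j.property) p (fun j ↦ by
      have h : j.obj.hom.left.hom ≫ j.obj.right.hom = j.obj.left.hom ≫ p :=
        CostructuredArrow.w j.obj.hom
      change (𝟙 _ ≫ j.obj.left.hom) ≫ p = j.obj.hom.left.hom ≫ 𝟙 _ ≫ j.obj.right.hom
      rw [Category.id_comp, Category.id_comp, h])

/-! ### Existence of pullbacks -/

section PullbackIndex

variable (κ) in
/-- The category of `κ`-presentable objects equipped with morphisms to `X` and `Y` equalizing
`f : X ⟶ Z` and `g : Y ⟶ Z`. -/
structure PullbackIndex {X Y Z : A} (f : X ⟶ Z) (g : Y ⟶ Z) where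
  /-- the `κ`-presentable object -/
  pt : A
  property : isCardinalPresentable A κ pt
  /-- the morphism to `X` -/
  fst : pt ⟶ X
  /-- the morphism to `Y` -/
  snd : pt ⟶ Y
  w : fst ≫ f = snd ≫ g

namespace PullbackIndex

variable {X Y Z : A} {f : X ⟶ Z} {g : Y ⟶ Z}

/-- The morphisms in the category `PullbackIndex κ f g`. -/
@[ext]
structure Hom (S T : PullbackIndex κ f g) where
  /-- the morphism between the `κ`-presentable objects -/
  hom : S.pt ⟶ T.pt
  fst : hom ≫ T.fst = S.fst := by cat_disch
  snd : hom ≫ T.snd = S.snd := by cat_disch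

attribute [simp] Hom.fst Hom.snd

@[simps]
instance : Category (PullbackIndex κ f g) where
  Hom := Hom
  id S := { hom := 𝟙 _ }
  comp a b := { hom := a.hom ≫ b.hom }

@[ext]
lemma hom_ext {S T : PullbackIndex κ f g} {a b : S ⟶ T} (h : a.hom = b.hom) : a = b :=
  Hom.ext h

variable (f g) in
/-- The projection from `PullbackIndex κ f g` to the category of objects over `X`. -/
def toFst : PullbackIndex κ f g ⥤ CostructuredArrow (isCardinalPresentable A κ).ι X where
  obj S := { left := ⟨S.pt, S.property⟩, right := ⟨⟨⟩⟩, hom := by exact S.fst }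
  map a := CostructuredArrow.homMk (ObjectProperty.homMk a.hom) (by exact a.fst)

variable (f g) in
/-- The projection from `PullbackIndex κ f g` to the category of objects over `Y`. -/
def toSnd : PullbackIndex κ f g ⥤ CostructuredArrow (isCardinalPresentable A κ).ι Y where
  obj S := { left := ⟨S.pt, S.property⟩, right := ⟨⟨⟩⟩, hom := by exact S.snd }
  map a := CostructuredArrow.homMk (ObjectProperty.homMk a.hom) (by exact a.snd)

variable (f g) in
/-- The embedding of `PullbackIndex κ f g` into the category of pairs of morphisms to `X`
and `Y`. -/
def toPair : PullbackIndex κ f g ⥤ CostructuredArrow ((isCardinalPresentable A κ).ι.prod'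
    (isCardinalPresentable A κ).ι) (X, Y) where
  obj S := { left := ⟨S.pt, S.property⟩, right := ⟨⟨⟩⟩, hom := by exact (S.fst, S.snd) }
  map a := CostructuredArrow.homMk (ObjectProperty.homMk a.hom) (by exact Prod.ext a.fst a.snd)

variable (f g) in
/-- The forgetful functor from `PullbackIndex κ f g`. -/
@[simps]
def forget : PullbackIndex κ f g ⥤ A where
  obj S := S.pt
  map a := a.hom

variable [IsCardinalAccessibleCategory A κ]

instance : EssentiallySmall.{w} (PullbackIndex κ f g) := by
  have : LocallySmall.{w} (A × A) := ⟨fun X Y ↦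
    inferInstanceAs (Small.{w} ((X.1 ⟶ Y.1) × (X.2 ⟶ Y.2)))⟩
  have : (toPair (κ := κ) f g).Faithful := ⟨fun h ↦ hom_ext congr(($h).left.hom)⟩
  have : (toPair (κ := κ) f g).Full := ⟨fun a ↦
    ⟨⟨a.left.hom, congr(($(CostructuredArrow.w a)).1), congr(($(CostructuredArrow.w a)).2)⟩, rfl⟩⟩
  exact essentiallySmall_of_fully_faithful (toPair (κ := κ) f g)

lemma exists_cocone_fst {S : Type w} [SmallCategory S] (F : S ⥤ PullbackIndex κ f g)
    (hS : HasCardinalLT (Arrow S) κ) :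
    ∃ (G : A) (_ : isCardinalPresentable A κ G) (a : G ⟶ X) (u : ∀ s, (F.obj s).pt ⟶ G),
      (∀ s, u s ≫ a = (F.obj s).fst) ∧ ∀ ⦃s s' : S⦄ (e : s ⟶ s'), (F.map e).hom ≫ u s' = u s := by
  let c := IsCardinalFiltered.cocone (F ⋙ toFst f g) hS
  exact ⟨c.pt.left.obj, c.pt.left.property, c.pt.hom, fun s ↦ (c.ι.app s).left.hom,
    fun s ↦ CostructuredArrow.w (c.ι.app s), fun _ _ e ↦ congr(($(c.w e)).left.hom)⟩

lemma exists_cocone_snd {S : Type w} [SmallCategory S] (F : S ⥤ PullbackIndex κ f g)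
    (hS : HasCardinalLT (Arrow S) κ) :
    ∃ (G : A) (_ : isCardinalPresentable A κ G) (a : G ⟶ Y) (u : ∀ s, (F.obj s).pt ⟶ G),
      (∀ s, u s ≫ a = (F.obj s).snd) ∧ ∀ ⦃s s' : S⦄ (e : s ⟶ s'), (F.map e).hom ≫ u s' = u s := by
  let c := IsCardinalFiltered.cocone (F ⋙ toSnd f g) hS
  exact ⟨c.pt.left.obj, c.pt.left.property, c.pt.hom, fun s ↦ (c.ι.app s).left.hom,
    fun s ↦ CostructuredArrow.w (c.ι.app s), fun _ _ e ↦ congr(($(c.w e)).left.hom)⟩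

end PullbackIndex

lemma exists_commSq_over [IsCardinalAccessibleCategory A κ] {S : Type*} (hS : HasCardinalLT S κ)
    {z : S → A} {x y E : A} (hz : ∀ s, isCardinalPresentable A κ (z s))
    (hx : isCardinalPresentable A κ x) (hy : isCardinalPresentable A κ y) (p : x ⟶ E) (q : y ⟶ E)
    (u : ∀ s, z s ⟶ x) (v : ∀ s, z s ⟶ y) (h : ∀ s, u s ≫ p = v s ≫ q) :
    ∃ (t : A) (_ : isCardinalPresentable A κ t) (a : x ⟶ t) (b : y ⟶ t) (r : t ⟶ E),
      a ≫ r = p ∧ b ≫ r = q ∧ ∀ s, u s ≫ a = v s ≫ b := by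
  let z' (s : S) : CostructuredArrow (isCardinalPresentable A κ).ι E :=
    CostructuredArrow.mk (Y := ⟨z s, hz s⟩) (by exact u s ≫ p)
  let x' : CostructuredArrow (isCardinalPresentable A κ).ι E :=
    CostructuredArrow.mk (Y := ⟨x, hx⟩) (by exact p)
  let y' : CostructuredArrow (isCardinalPresentable A κ).ι E :=
    CostructuredArrow.mk (Y := ⟨y, hy⟩) (by exact q)
  let α (s : S) : z' s ⟶ x' := CostructuredArrow.homMk (ObjectProperty.homMk (u s)) rfl
  let β (s : S) : z' s ⟶ y' := CostructuredArrow.homMk (ObjectProperty.homMk (v s)) (h s).symm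
  obtain ⟨t, a, b, hab⟩ := exists_commSq hS α β
  exact ⟨t.left.obj, t.left.property, a.left.hom, b.left.hom, t.hom, CostructuredArrow.w a,
    CostructuredArrow.w b, fun s ↦ congr(($(hab s)).left.hom)⟩

/-- Cocone vertices `G` over `X` and `H` over `Y` are joined by a `κ`-presentable `t` over `Z`. The
criterion replaces `G ⟶ t` by an arrow of `Q`, whose pullback along `H ⟶ t` exists, is
`κ`-presentable, and is the vertex sought. -/
lemma PullbackIndex.isCardinalFiltered [IsCardinalAccessibleCategory A κ] (hQ : IsQEEpiClass Q)
    {X Y Z : A} {f : X ⟶ Z} (g : Y ⟶ Z) (hf : HasLifts κ (extend κ Q) f) :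
    IsCardinalFiltered (PullbackIndex κ f g) κ where
  nonempty_cocone {S} _ F hS := by
    obtain ⟨G, hG, x, u, hu, hu'⟩ := exists_cocone_fst F hS
    obtain ⟨H, hH, y, v, hv, hv'⟩ := exists_cocone_snd F hS
    obtain ⟨t, ht, a, b, r, ha, hb, h⟩ := exists_commSq_over (hasCardinalLT_of_arrow hS)
      (fun s ↦ (F.obj s).property) hG hH (x ≫ f) (y ≫ g) u v
      (fun s ↦ by simp only [reassoc_of% hu, reassoc_of% hv, (F.obj s).w])
    obtain ⟨D', q, s₀, t₀, hq, h₁, h₂, h₃⟩ := hf hG ht a x r ha.symm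
    obtain ⟨T, b', q', hT, hq'⟩ := exists_isPullback_extend hQ hq b hH
    refine ⟨{
      pt :=
        { pt := T
          property := hq'.1
          fst := b' ≫ t₀
          snd := q' ≫ y
          w := by simp [h₃, hT.w_assoc, hb] }
      ι.app s :=
        { hom := hT.lift (u s ≫ s₀) (v s) (by simp [h₁, h])
          fst := by simp [h₂, hu]
          snd := by simp [hv] }
      ι.naturality s s' e := by
        apply PullbackIndex.hom_ext
        apply hT.hom_ext
        · simp [reassoc_of% hu' e]
        · simp [hv'] }⟩

lemma hasPullback_of_hasLifts [IsCardinalAccessibleCategory A κ] (hQ : IsQEEpiClass Q)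
    {D E E' : A} {p : D ⟶ E} (hp : HasLifts κ (extend κ Q) p) (f : E' ⟶ E) :
    HasPullback p f := by
  have := PullbackIndex.isCardinalFiltered hQ f hp
  have := IsCardinalFiltered.of_equivalence κ (equivSmallModel.{w} (PullbackIndex κ p f))
  have := HasCardinalFilteredColimits.hasColimitsOfShape A κ
    (SmallModel.{w} (PullbackIndex κ p f))
  have : HasColimitsOfShape (PullbackIndex κ p f) A :=
    hasColimitsOfShape_of_equivalence (equivSmallModel.{w} (PullbackIndex κ p f)).symm
  let F := PullbackIndex.forget (κ := κ) p f
  let c₁ : Cocone F :=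
    { pt := D
      ι.app S := S.fst
      ι.naturality S T a := a.fst.trans (Category.comp_id _).symm }
  let c₂ : Cocone F :=
    { pt := E'
      ι.app S := S.snd
      ι.naturality S T a := a.snd.trans (Category.comp_id _).symm }
  have h₁ (S) : colimit.ι F S ≫ colimit.desc F c₁ = S.fst := colimit.ι_desc _ _
  have h₂ (S) : colimit.ι F S ≫ colimit.desc F c₂ = S.snd := colimit.ι_desc _ _
  refine IsPullback.hasPullback (fst := colimit.desc F c₁) (snd := colimit.desc F c₂)
    (isPullback_of_presentable κ ?_ ?_ ?_)
  · refine colimit.hom_ext fun S ↦ ?_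
    rw [reassoc_of% h₁, reassoc_of% h₂]
    exact S.w
  · intro T hT a b w
    -- The pair `(a, b)` is itself an object of the index category.
    exact ⟨colimit.ι F ⟨T, hT, a, b, w⟩, h₁ _, h₂ _⟩
  · intro T hT l l' w₁ w₂
    have : IsCardinalPresentable T κ := hT
    obtain ⟨i, l, rfl⟩ := IsCardinalPresentable.exists_hom_of_isColimit κ (colimit.isColimit F) l
    obtain ⟨j, l', rfl⟩ := IsCardinalPresentable.exists_hom_of_isColimit κ (colimit.isColimit F) l'
    rw [Category.assoc, Category.assoc] at w₁ w₂
    have w₁ : l ≫ i.fst = l' ≫ j.fst := by rw [← h₁, ← h₁]; exact w₁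
    have w₂ : l ≫ i.snd = l' ≫ j.snd := by rw [← h₂, ← h₂]; exact w₂
    -- Having equal legs, `l` and `l'` are index morphisms from one common object, so the colimit
    -- identifies them.
    let S : PullbackIndex κ p f :=
      ⟨T, hT, l ≫ i.fst, l ≫ i.snd,
        (Category.assoc _ _ _).trans (congr(l ≫ $(i.w)).trans (Category.assoc _ _ _).symm)⟩
    let a : S ⟶ i := { hom := l, fst := rfl, snd := rfl }
    let b : S ⟶ j := { hom := l', fst := w₁.symm, snd := w₂.symm }
    exact (colimit.w F a).trans (colimit.w F b).symm

end PullbackIndex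

end QE

namespace QE

/-! ### Diagrams of shape `K ⇉ D ⟶ E` -/

section Forks

open WithTerminal WalkingParallelPair WalkingParallelPairHom

variable {C : Type u} [Category.{v} C]

/-- The diagram of shape `ForkShape` given by morphisms `k₁, k₂ : K ⟶ D` coequalized by
`p : D ⟶ E`. -/
def forkDiagram {K D E : C} (k₁ k₂ : K ⟶ D) (p : D ⟶ E) (w : k₁ ≫ p = k₂ ≫ p) : ForkShape ⥤ C :=
  WithTerminal.lift (parallelPair k₁ k₂) (Z := E)
    (fun x ↦ match x with
      | zero => k₁ ≫ p
      | one => p)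
    (by rintro _ _ (_ | _ | _) <;> simp [w])

/-- A morphism of diagrams of shape `ForkShape` is determined by its three components. -/
def forkHom {F G : ForkShape ⥤ C} (a₀ : F.obj (incl.obj zero) ⟶ G.obj (incl.obj zero))
    (a₁ : F.obj (incl.obj one) ⟶ G.obj (incl.obj one))
    (a₂ : F.obj WithTerminal.star ⟶ G.obj WithTerminal.star)
    (h₁ : F.map (incl.map left) ≫ a₁ = a₀ ≫ G.map (incl.map left))
    (h₂ : F.map (incl.map right) ≫ a₁ = a₀ ≫ G.map (incl.map right))
    (h₃ : F.map (homFrom one) ≫ a₂ = a₁ ≫ G.map (homFrom one)) : F ⟶ G where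
  app x := match x with
    | of zero => a₀
    | of one => a₁
    | WithTerminal.star => a₂
  naturality x y f := by
    have id_comp' {x : ForkShape} (a : F.obj x ⟶ G.obj x) : F.map (𝟙 x) ≫ a = a ≫ G.map (𝟙 x) := by
      simp
    rcases x with (_ | _) | _ <;> rcases y with (_ | _) | _
    · obtain ⟨⟨⟩, rfl⟩ : ∃ g : zero ⟶ zero, f = incl.map g := ⟨f, rfl⟩
      exact id_comp' (x := incl.obj zero) a₀
    · obtain ⟨⟨⟩, rfl⟩ : ∃ g : zero ⟶ one, f = incl.map g := ⟨f, rfl⟩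
      exacts [h₁, h₂]
    · obtain rfl : f = incl.map left ≫ homFrom one := Subsingleton.elim _ _
      change F.map (incl.map left ≫ homFrom one) ≫ a₂ = a₀ ≫ G.map (incl.map left ≫ homFrom one)
      rw [Functor.map_comp, Functor.map_comp, Category.assoc, h₃, reassoc_of% h₁]
    · obtain ⟨⟨⟩, rfl⟩ : ∃ g : one ⟶ zero, f = incl.map g := ⟨f, rfl⟩
    · obtain ⟨⟨⟩, rfl⟩ : ∃ g : one ⟶ one, f = incl.map g := ⟨f, rfl⟩
      exact id_comp' (x := incl.obj one) a₁
    · exact h₃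
    · exact PEmpty.elim f
    · exact PEmpty.elim f
    · exact id_comp' (x := WithTerminal.star) a₂

end Forks

/-! ### The two halves of the theorem -/

variable {A : Type u} [Category.{v} A] {κ : Cardinal.{w}} [Fact κ.IsRegular]
  {Q : MorphismProperty (Presentables A κ)} [IsCardinalAccessibleCategory A κ]

lemma isStrongQEEpiClass_lim [HasFiniteCoproducts A] (hQ : IsStrongQEEpiClass Q) :
    IsStrongQEEpiClass (lim κ Q) where
  hasPullback p f hp :=
    hasPullback_of_hasLifts hQ.toIsQEEpiClass (lim_hasLifts hQ.toIsQEEpiClass hp) f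
  stable h hp := lim_of_hasLifts (hasLifts_stable h (lim_hasLifts hQ.toIsQEEpiClass hp))
  coequalizer {K D E p k₁ k₂} h hp := by
    have := epi_of_lim hQ.toIsQEEpiClass hp
    have key (s : Cofork k₁ k₂) : ∃ u, p ≫ u = s.π :=
      exists_desc_lim hQ.toIsQEEpiClass hp s.π fun t₁ t₂ ht ↦ by
        simpa using congr(h.lift t₁ t₂ ht ≫ $s.condition)
    choose u hu using key
    exact ⟨Cofork.IsColimit.mk _ u hu fun s m hm ↦ by
      rw [← cancel_epi p, hu]
      exact hm⟩
  id_mem X := lim_of_hasLifts (hasLifts_id hQ.toIsQEEpiClass X)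
  comp_mem f g hf hg := lim_of_hasLifts (hasLifts_comp hQ.toIsQEEpiClass
    (lim_hasLifts hQ.toIsQEEpiClass hf) (lim_hasLifts hQ.toIsQEEpiClass hg))
  of_comp q p h := lim_of_hasLifts (hasLifts_of_comp hQ (lim_hasLifts hQ.toIsQEEpiClass h))

lemma extend_of_lim (hQ : IsStrongQEEpiClass Q) {D E : A} {p : D ⟶ E} (hp : lim κ Q p)
    (hD : isCardinalPresentable A κ D) (hE : isCardinalPresentable A κ E) : extend κ Q p :=
  extend_of_hasLifts hQ (lim_hasLifts hQ.toIsQEEpiClass hp) hD hE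

lemma lim_of_extend (hQ : IsQEEpiClass Q) {D E : A} {p : D ⟶ E} (hp : extend κ Q p) : lim κ Q p :=
  lim_of_hasLifts (hasLifts_of_extend hQ hp)

lemma sequences_of_directedColimits (hQ : IsStrongQEEpiClass Q) {F : ForkShape ⥤ A}
    (hF : directedColimits κ (fun G : ForkShape ⥤ A =>
      sequences (lim κ Q) G ∧ ∀ i, isCardinalPresentable A κ (G.obj i)) F) :
    sequences (lim κ Q) F := by
  obtain ⟨J, _, _, ⟨pres⟩⟩ := hF
  -- Colimits of shape `J` in `A` make evaluation at each vertex preserve them.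
  have := HasCardinalFilteredColimits.hasColimitsOfShape A κ J
  have hc (x : ForkShape) := isColimitOfPreserves ((evaluation _ A).obj x) pres.isColimit
  let τ {x y : ForkShape} (f : x ⟶ y) := Functor.whiskerLeft pres.diag ((evaluation _ A).map f)
  have hτ {x y : ForkShape} (f : x ⟶ y) (j : J) :
      (pres.ι.app j).app x ≫ F.map f = (pres.diag.obj j).map f ≫ (pres.ι.app j).app y :=
    ((pres.ι.app j).naturality f).symm
  exact ⟨directedColimitsHom_of_isColimit (hc _) (hc _) (τ (WithTerminal.homFrom _))
      (fun j ↦ extend_of_lim hQ (pres.prop_diag_obj j).1.1 ((pres.prop_diag_obj j).2 _)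
        ((pres.prop_diag_obj j).2 _)) _ (hτ _),
    isPullback_of_isColimit κ (fst := τ _) (snd := τ _) (f := τ _) (g := τ _)
      (fun j ↦ (pres.prop_diag_obj j).1.2) (hc _) (hc _) (hc _) (hc _)
      (hτ _) (hτ _) (hτ _) (hτ _)⟩

/-- Kernel pairs taken at each stage of a presentation of `p` are functorial and `κ`-presentable,
and their colimit is the kernel pair of `p` by `isColimit_of_isPullback`. -/
lemma directedColimits_of_sequences (hQ : IsQEEpiClass Q) {F : ForkShape ⥤ A}
    (hF : sequences (lim κ Q) F) :
    directedColimits κ (fun G : ForkShape ⥤ A =>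
      sequences (lim κ Q) G ∧ ∀ i, isCardinalPresentable A κ (G.obj i)) F := by
  obtain ⟨hp, hk⟩ := hF
  obtain ⟨J, _, _, X₁, X₂, c₁, c₂, f, ⟨h₁⟩, ⟨h₂⟩, hf, hp⟩ := hp.exists_presentation
  choose K k₁ k₂ hK hker using fun j ↦ exists_kernelPair_extend hQ (hf j)
  let N : J ⥤ A :=
    { obj := K
      map {i j} a := (hker j).lift (k₁ i ≫ X₁.map a) (k₂ i ≫ X₁.map a)
        (by simp [(hker i).w_assoc])
      map_id i := (hker i).hom_ext (by simp) (by simp)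
      map_comp a b := (hker _).hom_ext (by simp) (by simp) }
  let n₁ : N ⟶ X₁ := { app := k₁ }
  let n₂ : N ⟶ X₁ := { app := k₂ }
  -- A fork of functors on `J`; its flip is the required `J`-diagram of forks.
  let G := forkDiagram n₁ n₂ f (by ext j; exact (hker j).w)
  let l (j : J) := hk.lift (k₁ j ≫ c₁.app j) (k₂ j ≫ c₁.app j) (by
    simp only [Category.assoc, hp, (hker j).w_assoc])
  have hl₁ (j : J) : l j ≫ F.map _ = k₁ j ≫ c₁.app j := hk.lift_fst _ _ _
  have hl₂ (j : J) : l j ≫ F.map _ = k₂ j ≫ c₁.app j := hk.lift_snd _ _ _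
  let φ (j : J) : G.flip.obj j ⟶ F := forkHom (l j) (c₁.app j) (c₂.app j) (hl₁ j).symm
    (hl₂ j).symm (hp j).symm
  let c₀ : Cocone N :=
    { pt := F.obj (WithTerminal.incl.obj WalkingParallelPair.zero)
      ι.app := l
      ι.naturality i j a := by
        have h := c₁.naturality a
        dsimp at h ⊢
        rw [Category.comp_id] at h ⊢
        refine hk.hom_ext ?_ ?_
        · rw [Category.assoc, hl₁, hl₁, ← h]
          exact (hker j).lift_fst_assoc _ _ _ _ |>.trans (Category.assoc _ _ _)
        · rw [Category.assoc, hl₂, hl₂, ← h]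
          exact (hker j).lift_snd_assoc _ _ _ _ |>.trans (Category.assoc _ _ _) }
  obtain ⟨h₀⟩ : Nonempty (IsColimit c₀) :=
    isColimit_of_isPullback κ (fst := n₁) (snd := n₂) (f := f) (g := f) hker h₁ h₁ h₂ hl₁ hl₂
      hp hp hk
  let c : Cocone G.flip :=
    { pt := F
      ι.app := φ
      ι.naturality i j a := by
        ext x
        rcases x with (_ | _) | _
        exacts [c₀.ι.naturality a, c₁.naturality a, c₂.naturality a] }
  have hc : IsColimit c := evaluationJointlyReflectsColimits _ fun x ↦ by
    rcases x with (_ | _) | _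
    exacts [h₀, h₁, h₂]
  exact ⟨J, inferInstance, inferInstance, ⟨{
    diag := G.flip
    ι := c.ι
    isColimit := hc
    prop_diag_obj j := ⟨⟨lim_of_extend hQ (hf j), hker j⟩, by
      rintro ((_ | _) | _)
      exacts [hK j, (hf j).1, (hf j).2.1]⟩ }⟩⟩

lemma isStronglyLocallyCoherent_lim [HasFiniteCoproducts A] (hQ : IsStrongQEEpiClass Q) :
    IsStronglyLocallyCoherent κ (lim κ Q) where
  toIsQEEpiClass := (isStrongQEEpiClass_lim hQ).toIsQEEpiClass
  sequences_iff _ :=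
    ⟨directedColimits_of_sequences hQ.toIsQEEpiClass, sequences_of_directedColimits hQ⟩
  presentable_pullback {D E D' E' p f f' p'} h hp hD hE hE' := by
    obtain ⟨T, a, b, hT, hb⟩ :=
      exists_isPullback_extend hQ.toIsQEEpiClass (extend_of_lim hQ hp hD hE) f hE'
    exact (isCardinalPresentable A κ).prop_of_iso (hT.isoIsPullback _ _ h) hb.1

/-- Kernel pairs among `κ`-presentable objects are kernel pairs in `A`, and a coequalizer in `A`
with all its terms in a full subcategory is one there. -/
lemma isStrongQEEpiClass_restrict {P : MorphismProperty A} (hP : IsStrongQEEpiClass P)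
    (hP' : IsStronglyLocallyCoherent κ P) : IsStrongQEEpiClass (restrict κ P) where
  hasPullback {D E E'} p f hp := by
    have := hP.hasPullback p.hom f.hom hp
    have h := IsPullback.of_hasPullback p.hom f.hom
    let T : Presentables A κ :=
      ⟨_, hP'.presentable_pullback h hp D.property E.property E'.property⟩
    let fst : T ⟶ D := ObjectProperty.homMk (pullback.fst p.hom f.hom)
    let snd : T ⟶ E' := ObjectProperty.homMk (pullback.snd p.hom f.hom)
    exact (isPullback_of_hom (fst := fst) (snd := snd) h).hasPullback
  stable h hp := hP.stable (isPullback_hom κ h) hp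
  coequalizer {K D E p k₁ k₂} h hp := by
    have hc := (hP.coequalizer (isPullback_hom κ h) hp).some
    have key (s : Cofork k₁ k₂) : ∃ u, p ≫ u = s.π := by
      obtain ⟨u, hu⟩ := Cofork.IsColimit.desc' hc s.π.hom congr(($s.condition).hom)
      exact ⟨ObjectProperty.homMk u, ObjectProperty.hom_ext _ hu⟩
    choose u hu using key
    exact ⟨Cofork.IsColimit.mk _ u hu fun s m hm ↦ ObjectProperty.hom_ext _
      (Cofork.IsColimit.hom_ext hc congr(($(hm.trans (hu s).symm)).hom))⟩
  id_mem X := hP.id_mem X.obj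
  comp_mem f g := hP.comp_mem f.hom g.hom
  of_comp q p := hP.of_comp q.hom p.hom

end QE

theorem theorem11p2 {A : Type u} [Category.{v} A] (κ : Cardinal.{w}) [Fact κ.IsRegular]
    [IsCardinalAccessibleCategory A κ] [HasFiniteCoproducts A] :
    (∀ Q : MorphismProperty (QE.Presentables A κ), QE.IsStrongQEEpiClass Q →
      QE.IsStrongQEEpiClass (QE.lim κ Q) ∧ QE.IsStronglyLocallyCoherent κ (QE.lim κ Q)) ∧
    (∀ P : MorphismProperty A, QE.IsStrongQEEpiClass P → QE.IsStronglyLocallyCoherent κ P →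
      QE.IsStrongQEEpiClass (QE.restrict κ P)) :=
  ⟨fun _ hQ ↦ ⟨QE.isStrongQEEpiClass_lim hQ, QE.isStronglyLocallyCoherent_lim hQ⟩,
    fun _ hP hP' ↦ QE.isStrongQEEpiClass_restrict hP hP'⟩
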